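/- Let $\mathbb{D}$ be the open unit disc and $\sigma$ area measure on $\mathbb{D}$ normalized so that $\sigma(\mathbb{D})=1$. For $1<p<\infty$ let $A^p$ be the Bergman space of analytic functions $f$ on $\mathbb{D}$ with $\|f\|_{A^p}=\left(\int_{\mathbb{D}}|f|^p\,d\sigma\right)^{1/p}<\infty$, and let $q$ be the conjugate exponent, $1/p+1/q=1$. A function $k\in A^q$ is the kernel of a functional $\varphi\in(A^p)^*$ if $\varphi(f)=\int_{\mathbb{D}} f\,\overline{k}\,d\sigma$ for all $f\in A^p$. A function $F\in A^p$ with $\|F\|_{A^p}=1$ is an extremal function for a functional $\varphi\in(A^p)^*$, $\varphi\neq 0$, if $$\operatorname{Re}\varphi(F)=\sup_{\|g\|_{A^p}=1}\operatorname{Re}\varphi(g)=\|\varphi\|.$$ For $f\in L^1(\sigma)$ the Bergman projection of $f$ is $(\mathcal{P}f)(z)=\int_{\mathbb{D}}\frac{f(\zeta)}{(1-\overline{\zeta}z)^2}\,d\sigma(\zeta)$, $z\in\mathbb{D}$. Write $\operatorname{sgn} w=w/|w|$ for $w\ne 0$ and $\operatorname{sgn} 0=0$. **Theorem.** Let $1<p<\infty$,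 $1/p+1/q=1$, and let $F\in A^p$ with $\|F\|_{A^p}=1$. Then the function $$k=\mathcal{P}\left(|F|^{p-1}\operatorname{sgn}F\right)$$ belongs to $A^q$, it is the kernel of a nonzero bounded functional on $A^p$, and $F$ is the unique extremal function for that functional. Furthermore, if $F$ is an extremal function for some nonzero functional $\varphi\in(A^p)^*$ with kernel $k\in A^q$, then $$\mathcal{P}\left(|F|^{p-1}\operatorname{sgn}F\right)=\frac{k}{\|\varphi\|}.$$ -/

import Mathlib

open MeasureTheory

/-- The open unit disc, as a type. -/
abbrev Disc : Type := Metric.ball (0 : ℂ) 1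

namespace Bergman

noncomputable section

/-- Normalized area measure on the unit disc. -/
def σ : Measure Disc := (ENNReal.ofReal Real.pi)⁻¹ • (volume : Measure ℂ).comap Subtype.val

instance : IsProbabilityMeasure σ := by
  constructor
  have h : (volume : Measure ℂ).comap (Subtype.val : Disc → ℂ) Set.univ
      = ENNReal.ofReal Real.pi := by
    rw [comap_subtype_coe_apply measurableSet_ball]
    rw [Set.image_univ, Subtype.range_coe, Complex.volume_ball]
    simp [ENNReal.ofReal, Real.toNNReal_of_nonneg Real.pi_pos.le]
    rfl
  rw [σ, Measure.smul_apply, h, smul_eq_mul]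
  exact ENNReal.inv_mul_cancel (by simpa using Real.pi_pos) ENNReal.ofReal_ne_top

instance : σ.IsOpenPosMeasure := by
  constructor
  intro U hU hne h0
  rw [σ, Measure.smul_apply, smul_eq_mul, mul_eq_zero,
    comap_subtype_coe_apply measurableSet_ball] at h0
  rcases h0 with h0 | h0
  · exact ENNReal.inv_ne_zero.2 ENNReal.ofReal_ne_top h0
  · have ho : IsOpen ((Subtype.val : Disc → ℂ) '' U) :=
      Metric.isOpen_ball.isOpenMap_subtype_val U hU
    exact (ho.measure_pos volume (hne.image _)).ne' h0

/-- A function on the disc is analytic if it is the restriction of a function that is complex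
differentiable on the disc. -/
def IsAnalytic (f : Disc → ℂ) : Prop :=
  ∃ g : ℂ → ℂ, DifferentiableOn ℂ g (Metric.ball 0 1) ∧ ∀ z : Disc, g z = f z

theorem IsAnalytic.continuous {f : Disc → ℂ} (hf : IsAnalytic f) : Continuous f := by
  obtain ⟨g, hg, h⟩ := hf
  have : f = (Metric.ball (0 : ℂ) 1).domRestrict g := funext fun z => (h z).symm
  rw [this]
  exact hg.continuousOn.domRestrict

/-- The analytic functions `f` on the disc with `∫ |f|^p dσ < ∞`, as a linear subspace of all
functions. -/
def submodule (p : ℝ) : Submodule ℂ (Disc → ℂ) where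
  carrier := {f | IsAnalytic f ∧ MemLp f (ENNReal.ofReal p) σ}
  zero_mem' := ⟨⟨0, differentiableOn_const 0, fun _ => rfl⟩, MemLp.zero⟩
  add_mem' := by
    rintro f₁ f₂ ⟨⟨g₁, hg₁, h₁⟩, m₁⟩ ⟨⟨g₂, hg₂, h₂⟩, m₂⟩
    exact ⟨⟨g₁ + g₂, hg₁.add hg₂, fun z => by simp [h₁, h₂]⟩, m₁.add m₂⟩
  smul_mem' := by
    rintro c f ⟨⟨g, hg, h⟩, m⟩
    exact ⟨⟨c • g, hg.const_smul c, fun z => by simp [h]⟩, m.const_smul c⟩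

/-- The Bergman space `A^p`: its elements are functions. This is a separate type, so that it carries
the topology of its norm and not that of pointwise convergence. -/
def Space (p : ℝ) : Type := submodule p

instance (p : ℝ) : AddCommGroup (Space p) := inferInstanceAs (AddCommGroup (submodule p))

instance (p : ℝ) : Module ℂ (Space p) := inferInstanceAs (Module ℂ (submodule p))

/-- The inclusion of `A^p` into the space of all functions on the disc. -/
def Space.toFun {p : ℝ} : Space p →ₗ[ℂ] (Disc → ℂ) := (submodule p).subtype

instance (p : ℝ) : CoeFun (Space p) (fun _ => Disc → ℂ) := ⟨fun f => Space.toFun f⟩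

theorem Space.isAnalytic {p : ℝ} (f : Space p) : IsAnalytic f := f.property.1

theorem Space.memLp {p : ℝ} (f : Space p) : MemLp f (ENNReal.ofReal p) σ := f.property.2

theorem Space.exists_iff {p : ℝ} (f : Disc → ℂ) :
    (∃ g : Space p, (g : Disc → ℂ) = f) ↔ IsAnalytic f ∧ MemLp f (ENNReal.ofReal p) σ :=
  ⟨by rintro ⟨g, rfl⟩; exact ⟨g.isAnalytic, g.memLp⟩, fun h => ⟨⟨f, h⟩, rfl⟩⟩

theorem Space.ext {p : ℝ} {f g : Space p} (h : (f : Disc → ℂ) = g) : f = g := Subtype.ext h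

instance (p : ℝ) [Fact (1 < p)] : Fact (1 ≤ ENNReal.ofReal p) :=
  ⟨by simpa using (Fact.out : 1 < p).le⟩

/-- The map from `A^p` to `L^p` sending a function to its class modulo null sets. -/
def toLp (p : ℝ) : Space p →ₗ[ℂ] Lp ℂ (ENNReal.ofReal p) σ where
  toFun f := f.memLp.toLp f
  map_add' _ _ := rfl
  map_smul' _ _ := rfl

theorem toLp_injective (p : ℝ) : Function.Injective (toLp p) := by
  intro f g h
  have h' : (f : Disc → ℂ) =ᵐ[σ] g := (MemLp.toLp_eq_toLp_iff f.memLp g.memLp).1 h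
  exact Space.ext ((Continuous.ae_eq_iff_eq σ f.isAnalytic.continuous g.isAnalytic.continuous).1 h')

/-- The norm of `A^p` is the `L^p(σ)` norm; see `norm_eq`. -/
instance (p : ℝ) [Fact (1 < p)] : NormedAddCommGroup (Space p) :=
  NormedAddCommGroup.induced (Space p) (Lp ℂ (ENNReal.ofReal p) σ) (toLp p) (toLp_injective p)

instance (p : ℝ) [Fact (1 < p)] : NormedSpace ℂ (Space p) :=
  NormedSpace.induced ℂ (Space p) (Lp ℂ (ENNReal.ofReal p) σ) (toLp p)

theorem norm_eq (p : ℝ) [Fact (1 < p)] (f : Space p) :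
    ‖f‖ = (∫ z, ‖f z‖ ^ p ∂σ) ^ (1 / p) := by
  have hp : 0 < p := one_pos.trans Fact.out
  have h : ‖f‖ = (eLpNorm f (ENNReal.ofReal p) σ).toReal :=
    Lp.norm_toLp _ f.memLp
  rw [h, f.memLp.eLpNorm_eq_integral_rpow_norm (by simpa using hp) ENNReal.ofReal_ne_top,
    ENNReal.toReal_ofReal hp.le, ENNReal.toReal_ofReal (by positivity), one_div]

/-- The kernel `k ∈ A^q` represents the functional `φ` on `A^p`. -/
def HasKernel {p q : ℝ} [Fact (1 < p)] (φ : Space p →L[ℂ] ℂ) (k : Space q) : Prop :=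
  ∀ f : Space p, φ f = ∫ z, f z * starRingEnd ℂ (k z) ∂σ

/-- `F` is an extremal function for the nonzero functional `φ`: it has norm one, and
`Re φ(F) = sup {Re φ(g) : ‖g‖ = 1} = ‖φ‖`. -/
structure IsExtremal {p : ℝ} [Fact (1 < p)] (φ : Space p →L[ℂ] ℂ) (F : Space p) : Prop where
  ne_zero : φ ≠ 0
  norm_eq_one : ‖F‖ = 1
  isLUB : IsLUB {t : ℝ | ∃ g : Space p, ‖g‖ = 1 ∧ t = (φ g).re} (φ F).re
  eq_norm : (φ F).re = ‖φ‖

/-- The Bergman projection `(P f)(z) = ∫ f(ζ) / (1 - conj ζ * z)^2 dσ(ζ)`. -/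
def proj (f : Disc → ℂ) (z : Disc) : ℂ :=
  ∫ ζ : Disc, f ζ / (1 - starRingEnd ℂ (ζ : ℂ) * (z : ℂ)) ^ 2 ∂σ

/-- The complex sign `sgn w = w / |w|`, with `sgn 0 = 0`. -/
def sgn (w : ℂ) : ℂ := w / (‖w‖ : ℂ)

/-- The function `|F|^(p-1) sgn F`. -/
def dualFun (p : ℝ) (F : Disc → ℂ) (z : Disc) : ℂ :=
  ((‖F z‖ ^ (p - 1) : ℝ) : ℂ) * sgn (F z)

end

end Bergman

/-! Write `J w = |w|^(p-1) sgn w` (this is `dualMap`). Two facts carry the proof.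

First, the Bergman projection is bounded on `L^q` by Schur's test with a power of `1 - |z|^2` as
weight (`exists_lintegral_absKernel_rpow_le`), and it reproduces integrable analytic functions
(`proj_eq_self`). By Fubini and the symmetry of the kernel, `J F` and its projection then define the
same functional on `A^p` (`integral_mul_conj_proj`).

Second, `|a|^p + p Re((b - a) conj (J a)) ≤ |b|^p`, strictly if `a ≠ b` (`norm_rpow_add_mul_lt`):
this is strict convexity of `|w|^p`, with `p J a` as gradient. The functional of `J F` has norm one
by Hölder and attains it at `F`. A second extremal function would give equality in the integrated
inequality, hence coincide with `F`.

Conversely, if `F` is extremal for `φ`, integrating the inequality at `F + t f` and letting `t → 0`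
shows that `φ / ‖φ‖` is the functional of `J F`. Testing on the Bergman kernel functions gives the
formula for `k`. -/

open scoped ENNReal in
/-- **Schur's test.** -/
theorem MeasureTheory.lintegral_schur {X : Type*} [MeasurableSpace X] {μ : Measure X} [SFinite μ]
    {p q : ℝ} (hpq : p.HolderConjugate q) {K : X → X → ℝ≥0∞}
    (hK : Measurable (Function.uncurry K)) {u : X → ℝ≥0∞} (hu : Measurable u)
    (u_ne_zero : ∀ x, u x ≠ 0) (u_ne_top : ∀ x, u x ≠ ∞) {A B : ℝ≥0∞}
    (hA : ∀ x, ∫⁻ y, K x y * u y ^ p ∂μ ≤ A * u x ^ p)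
    (hB : ∀ y, ∫⁻ x, K x y * u x ^ q ∂μ ≤ B * u y ^ q)
    {f : X → ℝ≥0∞} (hf : Measurable f) :
    ∫⁻ x, (∫⁻ y, K x y * f y ∂μ) ^ q ∂μ ≤ A ^ (q / p) * B * ∫⁻ y, f y ^ q ∂μ := by
  have hp := hpq.pos
  have hq := hpq.symm.pos
  have hKx : ∀ x, Measurable (K x) := fun x => hK.of_uncurry_left
  have hKy : ∀ y, Measurable fun x => K x y := fun y => hK.of_uncurry_right
  have key : ∀ x, (∫⁻ y, K x y * f y ∂μ) ^ q ≤
      A ^ (q / p) * ∫⁻ y, u x ^ q * (K x y * (f y / u y) ^ q) ∂μ := by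
    intro x
    -- Hölder is applied to the splitting `K f = (K^(1/p) u) (K^(1/q) f / u)`: the first factor is
    -- controlled by `hA`, the second by `hB` after Tonelli.
    have h1 : ∫⁻ y, K x y * f y ∂μ
        = ∫⁻ y, ((fun y => K x y ^ (1 / p) * u y) * fun y => K x y ^ (1 / q) * (f y / u y)) y ∂μ := by
      refine lintegral_congr fun y => ?_
      have : K x y = K x y ^ (1 / p) * K x y ^ (1 / q) := by
        rw [← ENNReal.rpow_add_of_nonneg _ _ (by positivity) (by positivity),
          one_div, one_div, hpq.inv_add_inv_eq_one, ENNReal.rpow_one]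
      simp only [Pi.mul_apply]
      rw [mul_mul_mul_comm, ← this, ENNReal.mul_div_cancel (u_ne_zero y) (u_ne_top y)]
    have h2 := ENNReal.lintegral_mul_le_Lp_mul_Lq μ hpq
      (f := fun y => K x y ^ (1 / p) * u y) (g := fun y => K x y ^ (1 / q) * (f y / u y))
      (((hKx x).pow_const _).mul hu).aemeasurable
      (((hKx x).pow_const _).mul (hf.div hu)).aemeasurable
    rw [← h1] at h2
    simp only [ENNReal.mul_rpow_of_nonneg _ _ hp.le, ENNReal.mul_rpow_of_nonneg _ _ hq.le,
      ← ENNReal.rpow_mul, one_div, inv_mul_cancel₀ hp.ne', inv_mul_cancel₀ hq.ne',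
      ENNReal.rpow_one] at h2
    calc (∫⁻ y, K x y * f y ∂μ) ^ q
        ≤ ((A * u x ^ p) ^ p⁻¹ * (∫⁻ y, K x y * (f y / u y) ^ q ∂μ) ^ q⁻¹) ^ q := by
          gcongr
          exact h2.trans (by gcongr; exact hA x)
      _ = A ^ (q / p) * (u x ^ q * ∫⁻ y, K x y * (f y / u y) ^ q ∂μ) := by
          rw [ENNReal.mul_rpow_of_nonneg _ _ hq.le, ENNReal.mul_rpow_of_nonneg _ _ (by positivity),
            ENNReal.mul_rpow_of_nonneg _ _ hq.le, ← ENNReal.rpow_mul, ← ENNReal.rpow_mul,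
            ← ENNReal.rpow_mul, ← ENNReal.rpow_mul, inv_mul_cancel₀ hq.ne', ← mul_assoc p,
            mul_inv_cancel₀ hp.ne', ENNReal.rpow_one, one_mul, mul_assoc, inv_mul_eq_div]
      _ = _ := by
          rw [lintegral_const_mul]
          exact (hKx x).mul ((hf.div hu).pow_const _)
  have hm : Measurable (Function.uncurry fun x y => u x ^ q * (K x y * (f y / u y) ^ q)) :=
    ((hu.comp measurable_fst).pow_const _).mul
      (hK.mul (((hf.div hu).comp measurable_snd).pow_const _))
  calc ∫⁻ x, (∫⁻ y, K x y * f y ∂μ) ^ q ∂μ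
      ≤ ∫⁻ x, A ^ (q / p) * ∫⁻ y, u x ^ q * (K x y * (f y / u y) ^ q) ∂μ ∂μ :=
        lintegral_mono key
    _ = A ^ (q / p) * ∫⁻ y, ∫⁻ x, u x ^ q * (K x y * (f y / u y) ^ q) ∂μ ∂μ := by
        rw [lintegral_const_mul _ (f := fun x => ∫⁻ y, u x ^ q * (K x y * (f y / u y) ^ q) ∂μ)
          hm.lintegral_prod_right', lintegral_lintegral_swap hm.aemeasurable]
    _ = A ^ (q / p) * ∫⁻ y, (f y / u y) ^ q * ∫⁻ x, K x y * u x ^ q ∂μ ∂μ := by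
        congr 1
        refine lintegral_congr fun y => ?_
        rw [← lintegral_const_mul _ (f := fun x => K x y * u x ^ q) ((hKy y).mul (hu.pow_const _))]
        refine lintegral_congr fun x => ?_
        ring
    _ ≤ A ^ (q / p) * ∫⁻ y, B * f y ^ q ∂μ := by
        refine mul_le_mul_right (lintegral_mono fun y => ?_) _
        calc (f y / u y) ^ q * ∫⁻ x, K x y * u x ^ q ∂μ
            ≤ (f y / u y) ^ q * (B * u y ^ q) := by gcongr; exact hB y
          _ = B * (f y / u y * u y) ^ q := by
              rw [ENNReal.mul_rpow_of_nonneg _ _ hq.le]; ring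
          _ = B * f y ^ q := by rw [ENNReal.div_mul_cancel (u_ne_zero y) (u_ne_top y)]
    _ = _ := by rw [lintegral_const_mul _ (hf.pow_const _), mul_assoc]

namespace Bergman

noncomputable section

/-! ### Polar coordinates for the normalized area measure -/

/-- Polar coordinates on the disc, with the square of the radius as first coordinate. -/
def polarMap (x : ℝ × ℝ) : ℂ := circleMap 0 (√x.1) x.2

/-- The normalized measure in the angular variable. -/
def angleMeasure : Measure ℝ :=
  (ENNReal.ofReal (2 * Real.pi))⁻¹ • volume.restrict (Set.Ioo (-Real.pi) Real.pi)

theorem measurable_polarMap : Measurable polarMap := by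
  unfold polarMap circleMap; fun_prop

instance : IsFiniteMeasure angleMeasure := by
  constructor
  simp only [angleMeasure, Measure.smul_apply, Measure.restrict_apply_univ, Real.volume_Ioo,
    smul_eq_mul]
  exact ENNReal.mul_lt_top (ENNReal.inv_lt_top.2 (by simpa using Real.pi_pos)) ENNReal.ofReal_lt_top

theorem lintegral_σ (f : ℂ → ENNReal) :
    ∫⁻ z : Disc, f z ∂σ = (ENNReal.ofReal Real.pi)⁻¹ * ∫⁻ z in Metric.ball 0 1, f z := by
  rw [σ, lintegral_smul_measure, lintegral_subtype_comap measurableSet_ball, smul_eq_mul]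

/-- The substitution `t = r^2` absorbs the Jacobian: `r dr dθ / π = dt dθ / (2π)`. -/
theorem lintegral_σ_eq_polar {f : ℂ → ENNReal} (hf : Measurable f) :
    ∫⁻ z : Disc, f z ∂σ =
      ∫⁻ t in Set.Ioo (0 : ℝ) 1, ∫⁻ θ, f (polarMap (t, θ)) ∂angleMeasure := by
  have himg : (fun r : ℝ => r ^ 2) '' Set.Ioo 0 1 = Set.Ioo 0 1 := by
    ext t
    constructor
    · rintro ⟨r, ⟨h0, h1⟩, rfl⟩
      exact ⟨by positivity, by nlinarith⟩
    · rintro ⟨h0, h1⟩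
      exact ⟨√t, ⟨Real.sqrt_pos.2 h0, by rw [Real.sqrt_lt' one_pos]; simpa using h1⟩,
        Real.sq_sqrt h0.le⟩
  have hinj : Set.InjOn (fun r : ℝ => r ^ 2) (Set.Ioo 0 1) := by
    intro a ha b hb h
    exact (pow_left_inj₀ ha.1.le hb.1.le two_ne_zero).1 h
  rw [lintegral_σ, ← lintegral_indicator measurableSet_ball,
    ← Complex.lintegral_comp_polarCoord_symm]
  conv_rhs => rw [← himg]
  rw [lintegral_image_eq_lintegral_abs_deriv_mul (f' := fun r => 2 * r) measurableSet_Ioo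
    (fun r _ => by simpa using (hasDerivAt_pow 2 r).hasDerivWithinAt) hinj]
  rw [polarCoord_target, Measure.volume_eq_prod, ← Measure.prod_restrict,
    lintegral_prod _ (by
      have : Measurable fun p : ℝ × ℝ => Complex.polarCoord.symm p := by
        simp only [Complex.polarCoord_symm_apply]; fun_prop
      exact (ENNReal.measurable_ofReal.comp measurable_fst).smul
        ((hf.indicator measurableSet_ball).comp this) |>.aemeasurable)]
  rw [← lintegral_const_mul' _ _ (by simpa using Real.pi_pos),
    ← Set.Ioo_union_Ici_eq_Ioi (zero_lt_one' ℝ), lintegral_union measurableSet_Ici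
      (Set.disjoint_left.2 fun x hx hx' => not_lt.2 hx' hx.2)]
  rw [setLIntegral_congr_fun (g := fun _ => 0) measurableSet_Ici (by
    intro r hr
    have hr : (1 : ℝ) ≤ r := hr
    have : ∀ θ : ℝ, (Metric.ball 0 1).indicator f (Complex.polarCoord.symm (r, θ)) = 0 := by
      intro θ
      apply Set.indicator_of_notMem
      rw [mem_ball_zero_iff, Complex.norm_polarCoord_symm, abs_of_nonneg (by linarith)]
      exact not_lt.2 hr
    simp only [this, smul_zero, lintegral_zero, mul_zero]), lintegral_zero, add_zero]
  refine setLIntegral_congr_fun measurableSet_Ioo fun r hr => ?_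
  have h1 : ∀ θ : ℝ, (Metric.ball 0 1).indicator f (Complex.polarCoord.symm (r, θ))
      = f (polarMap (r ^ 2, θ)) := by
    intro θ
    rw [Set.indicator_of_mem (by
      rw [mem_ball_zero_iff, Complex.norm_polarCoord_symm, abs_of_pos hr.1]; exact hr.2)]
    simp [polarMap, circleMap, Real.sqrt_sq hr.1.le, Complex.exp_mul_I]
  simp only [h1, smul_eq_mul, angleMeasure, lintegral_smul_measure]
  rw [lintegral_const_mul' _ _ ENNReal.ofReal_ne_top, abs_of_pos (by linarith [hr.1]),
    ← mul_assoc, ← mul_assoc]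
  congr 1
  rw [ENNReal.ofReal_mul zero_le_two, ENNReal.ofReal_mul zero_le_two, mul_right_comm,
    ENNReal.mul_inv (by simp) (by simp), ← mul_assoc, ENNReal.mul_inv_cancel (by simp) (by simp),
    one_mul]

/-- Normalized area measure in polar coordinates. -/
theorem map_val_σ : σ.map Subtype.val =
    ((volume.restrict (Set.Ioo (0 : ℝ) 1)).prod angleMeasure).map polarMap := by
  ext s hs
  have hi : Measurable (s.indicator (1 : ℂ → ENNReal)) := measurable_one.indicator hs
  rw [← lintegral_indicator_one hs, ← lintegral_indicator_one hs,
    lintegral_map hi measurable_subtype_coe, lintegral_map hi measurable_polarMap,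
    lintegral_prod (fun x => s.indicator 1 (polarMap x)) (hi.comp measurable_polarMap).aemeasurable,
    lintegral_σ_eq_polar hi]

theorem integral_σ_eq_polar {f : ℂ → ℂ} (hf : Measurable f) (hi : Integrable (fun z : Disc => f z) σ) :
    ∫ z : Disc, f z ∂σ = ∫ t in Set.Ioo (0 : ℝ) 1, ∫ θ, f (polarMap (t, θ)) ∂angleMeasure := by
  have h : Integrable f (σ.map Subtype.val) :=
    (integrable_map_measure hf.aestronglyMeasurable measurable_subtype_coe.aemeasurable).2 hi
  have h2 := h
  rw [map_val_σ, integrable_map_measure hf.aestronglyMeasurable measurable_polarMap.aemeasurable]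
    at h2
  rw [← integral_map measurable_subtype_coe.aemeasurable hf.aestronglyMeasurable, map_val_σ,
    integral_map measurable_polarMap.aemeasurable hf.aestronglyMeasurable]
  exact integral_prod _ h2

theorem integral_angleMeasure_eq_circleAverage {E : Type*} [NormedAddCommGroup E] [NormedSpace ℝ E]
    (f : ℂ → E) (t : ℝ) :
    ∫ θ, f (polarMap (t, θ)) ∂angleMeasure = Real.circleAverage f 0 √t := by
  have hpi := Real.pi_pos
  rw [Real.circleAverage_eq_integral_add (-Real.pi),
    intervalIntegral.integral_comp_add_right (fun θ => f (circleMap 0 √t θ)),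
    intervalIntegral.integral_of_le (by linarith), integral_Ioc_eq_integral_Ioo, angleMeasure,
    integral_smul_measure]
  rw [ENNReal.toReal_inv, ENNReal.toReal_ofReal (by positivity)]
  congr 3
  ring_nf

/-! ### Integral estimates for the modulus of the Bergman kernel -/

/-- Splitting at `u = a` leaves `u^(-s) / a` below and `u^(-s-1)` above; these contribute the terms
`1/(1-s)` and `1/s`. -/
theorem lintegral_rpow_neg_div_max_le {s a : ℝ} (hs0 : 0 < s) (hs1 : s < 1) (ha : 0 < a) :
    ∫⁻ u in Set.Ioi (0 : ℝ), ENNReal.ofReal (u ^ (-s) / max a u) ≤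
      ENNReal.ofReal ((1 / s + 1 / (1 - s)) * a ^ (-s)) := by
  have h1 : ∫⁻ u in Set.Ioc 0 a, ENNReal.ofReal (u ^ (-s) / max a u)
      = ENNReal.ofReal (1 / (1 - s) * a ^ (-s)) := by
    have hi : IntegrableOn (fun u : ℝ => u ^ (-s) / a) (Set.Ioc 0 a) :=
      (intervalIntegrable_iff_integrableOn_Ioc_of_le ha.le).1
        ((intervalIntegral.intervalIntegrable_rpow' (by linarith)).div_const a)
    rw [setLIntegral_congr_fun (g := fun u => ENNReal.ofReal (u ^ (-s) / a)) measurableSet_Ioc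
      (fun u hu => by simp only [max_eq_left hu.2]),
      ← ofReal_integral_eq_lintegral_ofReal hi ((ae_restrict_mem measurableSet_Ioc).mono
        fun u hu => div_nonneg (Real.rpow_nonneg hu.1.le _) ha.le),
      ← intervalIntegral.integral_of_le ha.le, intervalIntegral.integral_div,
      integral_rpow (Or.inl (by linarith)), Real.zero_rpow (by linarith), sub_zero,
      Real.rpow_add_one ha.ne', neg_add_eq_sub]
    congr 1
    field_simp
  have h2 : ∫⁻ u in Set.Ioi a, ENNReal.ofReal (u ^ (-s) / max a u)
      = ENNReal.ofReal (1 / s * a ^ (-s)) := by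
    have hi : IntegrableOn (fun u : ℝ => u ^ (-s - 1)) (Set.Ioi a) :=
      integrableOn_Ioi_rpow_of_lt (by linarith) ha
    rw [setLIntegral_congr_fun (g := fun u => ENNReal.ofReal (u ^ (-s - 1))) measurableSet_Ioi
      (fun u (hu : a < u) => by
        simp only [max_eq_right hu.le, Real.rpow_sub_one (ha.trans hu).ne']),
      ← ofReal_integral_eq_lintegral_ofReal hi ((ae_restrict_mem measurableSet_Ioi).mono
        fun u hu => Real.rpow_nonneg (ha.trans hu).le _),
      integral_Ioi_rpow_of_lt (by linarith) ha, sub_add_cancel]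
    congr 1
    field_simp
  rw [← Set.Ioc_union_Ioi_eq_Ioi ha.le, lintegral_union measurableSet_Ioi
    (Set.disjoint_left.2 fun x hx hx' => not_lt.2 hx.2 hx'), h1, h2,
    ← ENNReal.ofReal_add (by have := sub_pos.2 hs1; positivity) (by positivity), add_comm (1 / s),
    add_mul]

/-- Since `1 - t x` dominates both `1 - x` and `1 - t`, the substitution `u = 1 - t` reduces this to
the preceding bound with `a = 1 - x`. -/
theorem lintegral_rpow_neg_div_one_sub_mul_le {s x : ℝ} (hs0 : 0 < s) (hs1 : s < 1) (hx0 : 0 ≤ x)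
    (hx1 : x < 1) :
    ∫⁻ t in Set.Ioo (0 : ℝ) 1, ENNReal.ofReal ((1 - t) ^ (-s) * (1 - t * x)⁻¹) ≤
      ENNReal.ofReal ((1 / s + 1 / (1 - s)) * (1 - x) ^ (-s)) := by
  refine le_trans ?_ (lintegral_rpow_neg_div_max_le hs0 hs1 (sub_pos.2 hx1))
  calc ∫⁻ t in Set.Ioo (0 : ℝ) 1, ENNReal.ofReal ((1 - t) ^ (-s) * (1 - t * x)⁻¹)
      ≤ ∫⁻ t in Set.Ioo (0 : ℝ) 1, (Set.Ioi (0 : ℝ)).indicator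
          (fun u => ENNReal.ofReal (u ^ (-s) / max (1 - x) u)) (1 - t) := by
        refine setLIntegral_mono' measurableSet_Ioo fun t ht => ?_
        have ht' : 0 < 1 - t := sub_pos.2 ht.2
        rw [Set.indicator_of_mem (by exact ht')]
        apply ENNReal.ofReal_le_ofReal
        rw [div_eq_mul_inv]
        have hm : max (1 - x) (1 - t) ≤ 1 - t * x :=
          max_le (by nlinarith [ht.1, ht.2]) (by nlinarith [ht.1, ht.2])
        have : 0 < max (1 - x) (1 - t) := lt_max_of_lt_right ht'
        gcongr
    _ ≤ ∫⁻ t, (Set.Ioi (0 : ℝ)).indicator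
          (fun u => ENNReal.ofReal (u ^ (-s) / max (1 - x) u)) (1 - t) :=
        setLIntegral_le_lintegral _ _
    _ = _ := by
        rw [lintegral_sub_left_eq_self (fun u => (Set.Ioi (0 : ℝ)).indicator
          (fun u => ENNReal.ofReal (u ^ (-s) / max (1 - x) u)) u) 1,
          lintegral_indicator measurableSet_Ioi]

theorem one_sub_conj_mul_ne_zero {w z : ℂ} (hw : ‖w‖ < 1) (hz : ‖z‖ < 1) :
    1 - starRingEnd ℂ w * z ≠ 0 := by
  intro h
  have : ‖starRingEnd ℂ w * z‖ = 1 := by rw [← sub_eq_zero.1 h, norm_one]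
  rw [norm_mul, RCLike.norm_conj] at this
  nlinarith [norm_nonneg w, norm_nonneg z]

/-- On the circle `|w|^2 = t` one has `w (1 - conj w * z) = w - t z`. The kernel thus becomes a
multiple of the Poisson kernel at `t z`, whose circle average is one. -/
theorem norm_one_sub_conj_mul_sq_inv_eq_poissonKernel {z w : ℂ} {t : ℝ} (ht0 : 0 < t) (ht1 : t < 1)
    (hz : ‖z‖ < 1) (hw : ‖w‖ = √t) :
    (‖1 - starRingEnd ℂ w * z‖ ^ 2)⁻¹ = (1 - t * ‖z‖ ^ 2)⁻¹ * poissonKernel 0 (t * z) w := by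
  have hw2 : ‖w‖ ^ 2 = t := by rw [hw, Real.sq_sqrt ht0.le]
  have hw0 : ‖w‖ ≠ 0 := by rw [hw]; exact (Real.sqrt_pos.2 ht0).ne'
  have hw1 : ‖w‖ < 1 := by rw [hw, Real.sqrt_lt' one_pos]; simpa using ht1
  have h1 : w - t * z = w * (1 - starRingEnd ℂ w * z) := by
    rw [← hw2]; push_cast; rw [← Complex.mul_conj']; ring
  have h2 : ‖1 - starRingEnd ℂ w * z‖ ≠ 0 := norm_ne_zero_iff.2 (one_sub_conj_mul_ne_zero hw1 hz)
  have h3 : 1 - t * ‖z‖ ^ 2 ≠ 0 := by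
    have : t * ‖z‖ ^ 2 < 1 := by nlinarith [norm_nonneg z, sq_nonneg ‖z‖]
    linarith
  rw [poissonKernel_def]
  simp only [sub_zero]
  rw [h1, norm_mul, norm_mul, Complex.norm_real, mul_pow, mul_pow, hw2, Real.norm_eq_abs, sq_abs]
  field_simp

theorem circleAverage_poissonKernel {w : ℂ} {R : ℝ} (hw : ‖w‖ < R) :
    Real.circleAverage (poissonKernel 0 w) 0 R = 1 := by
  have h := (diffContOnCl_const (𝕜 := ℂ) (c := (1 : ℂ))).circleAverage_poissonKernel_smul
    (mem_ball_zero_iff.2 hw)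
  rw [← Complex.ofReal_inj, Complex.ofReal_one, ← h, Real.circleAverage_def, Real.circleAverage_def]
  simp [intervalIntegral.integral_ofReal]

theorem lintegral_angle_kernel {z : ℂ} {t : ℝ} (ht0 : 0 < t) (ht1 : t < 1) (hz : ‖z‖ < 1) :
    ∫⁻ θ, ENNReal.ofReal (‖1 - starRingEnd ℂ (polarMap (t, θ)) * z‖ ^ 2)⁻¹ ∂angleMeasure
      = ENNReal.ofReal (1 - t * ‖z‖ ^ 2)⁻¹ := by
  have ht : √t < 1 := by rw [Real.sqrt_lt' one_pos]; simpa using ht1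
  have hne : ∀ w : ℂ, ‖w‖ < 1 → ‖1 - starRingEnd ℂ w * z‖ ≠ 0 := fun w hw =>
    norm_ne_zero_iff.2 (one_sub_conj_mul_ne_zero hw hz)
  have hnorm : ∀ θ, ‖polarMap (t, θ)‖ < 1 := fun θ => by
    simpa [polarMap, abs_of_nonneg (Real.sqrt_nonneg t)] using ht
  have hcont : Continuous fun θ => (‖1 - starRingEnd ℂ (polarMap (t, θ)) * z‖ ^ 2)⁻¹ := by
    refine Continuous.inv₀ ?_ fun θ => pow_ne_zero 2 (hne _ (hnorm θ))
    unfold polarMap circleMap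
    fun_prop
  have hint : Integrable (fun θ => (‖1 - starRingEnd ℂ (polarMap (t, θ)) * z‖ ^ 2)⁻¹)
      angleMeasure := by
    refine Integrable.smul_measure ?_ (ENNReal.inv_ne_top.2 (by simpa using Real.pi_pos))
    exact (hcont.integrableOn_Icc).mono_set Set.Ioo_subset_Icc_self
  rw [← ofReal_integral_eq_lintegral_ofReal hint (ae_of_all _ fun θ => by positivity),
    integral_angleMeasure_eq_circleAverage (fun w => (‖1 - starRingEnd ℂ w * z‖ ^ 2)⁻¹)]
  congr 1
  have hball : ‖t * z‖ < √t := by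
    rw [norm_mul, Complex.norm_real, Real.norm_eq_abs, abs_of_pos ht0]
    nlinarith [Real.sqrt_pos.2 ht0, Real.sq_sqrt ht0.le, norm_nonneg z]
  rw [Real.circleAverage_congr_sphere (f₂ := fun w => (1 - t * ‖z‖ ^ 2)⁻¹ • poissonKernel 0 (t * z) w),
    Real.circleAverage_fun_smul, circleAverage_poissonKernel hball, smul_eq_mul, mul_one]
  intro w hw
  rw [mem_sphere_zero_iff_norm, abs_of_nonneg (Real.sqrt_nonneg t)] at hw
  exact norm_one_sub_conj_mul_sq_inv_eq_poissonKernel ht0 ht1 hz hw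

theorem lintegral_rpow_mul_kernel_le {s : ℝ} (hs0 : 0 < s) (hs1 : s < 1) (z : Disc) :
    ∫⁻ w : Disc, ENNReal.ofReal ((1 - ‖(w : ℂ)‖ ^ 2) ^ (-s)) *
        ENNReal.ofReal (‖1 - starRingEnd ℂ (w : ℂ) * z‖ ^ 2)⁻¹ ∂σ ≤
      ENNReal.ofReal (1 / s + 1 / (1 - s)) * ENNReal.ofReal ((1 - ‖(z : ℂ)‖ ^ 2) ^ (-s)) := by
  have hz : ‖(z : ℂ)‖ < 1 := mem_ball_zero_iff.1 z.2
  have hs : 0 < 1 - s := sub_pos.2 hs1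
  rw [lintegral_σ_eq_polar (f := fun w => ENNReal.ofReal ((1 - ‖w‖ ^ 2) ^ (-s)) *
    ENNReal.ofReal (‖1 - starRingEnd ℂ w * z‖ ^ 2)⁻¹) (by fun_prop),
    ← ENNReal.ofReal_mul (by positivity)]
  refine le_trans (le_of_eq ?_) (lintegral_rpow_neg_div_one_sub_mul_le hs0 hs1 (sq_nonneg _)
    (by nlinarith [norm_nonneg (z : ℂ)]))
  refine setLIntegral_congr_fun measurableSet_Ioo fun t ht => ?_
  have hn : ∀ θ, ‖polarMap (t, θ)‖ ^ 2 = t := fun θ => by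
    simp [polarMap, Real.sq_sqrt ht.1.le]
  simp only [hn]
  rw [lintegral_const_mul' _ _ ENNReal.ofReal_ne_top, lintegral_angle_kernel ht.1 ht.2 hz,
    ENNReal.ofReal_mul (Real.rpow_nonneg (sub_nonneg.2 ht.2.le) _)]

/-! ### Boundedness and analyticity of the Bergman projection -/

theorem Disc.norm_lt_one (z : Disc) : ‖(z : ℂ)‖ < 1 := mem_ball_zero_iff.1 z.2

theorem one_sub_norm_le_norm_one_sub_conj_mul (w : Disc) (z : ℂ) :
    1 - ‖z‖ ≤ ‖1 - starRingEnd ℂ (w : ℂ) * z‖ := by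
  have h := norm_sub_norm_le (1 : ℂ) (starRingEnd ℂ (w : ℂ) * z)
  rw [norm_one, norm_mul, RCLike.norm_conj] at h
  nlinarith [norm_nonneg z, Disc.norm_lt_one w]

/-- The modulus of the Bergman kernel. -/
def absKernel (z w : Disc) : ENNReal :=
  ENNReal.ofReal (‖1 - starRingEnd ℂ (w : ℂ) * z‖ ^ 2)⁻¹

theorem measurable_uncurry_absKernel : Measurable (Function.uncurry absKernel) := by
  unfold absKernel Function.uncurry
  fun_prop

theorem absKernel_comm (z w : Disc) : absKernel z w = absKernel w z := by
  have : starRingEnd ℂ (1 - starRingEnd ℂ (w : ℂ) * z) = 1 - starRingEnd ℂ (z : ℂ) * w := by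
    simp [mul_comm]
  rw [absKernel, absKernel, ← this, RCLike.norm_conj]

theorem enorm_div_kernel (c : ℂ) (z w : Disc) :
    ‖c / (1 - starRingEnd ℂ (w : ℂ) * z) ^ 2‖ₑ = absKernel z w * ‖c‖ₑ := by
  rw [absKernel, ← ofReal_norm, ← ofReal_norm, norm_div, norm_pow, div_eq_inv_mul,
    ENNReal.ofReal_mul (by positivity)]

theorem exists_lintegral_absKernel_rpow_le {p q : ℝ} (hpq : p.HolderConjugate q) :
    ∃ C : ENNReal, C ≠ ⊤ ∧ ∀ f : Disc → ENNReal, Measurable f →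
      ∫⁻ z, (∫⁻ w, absKernel z w * f w ∂σ) ^ q ∂σ ≤ C * ∫⁻ w, f w ^ q ∂σ := by
  have hp := hpq.pos
  have hq := hpq.symm.pos
  have hp1 := hpq.lt
  have hq1 := hpq.symm.lt
  have hpos : ∀ z : Disc, 0 < 1 - ‖(z : ℂ)‖ ^ 2 := fun z => by
    nlinarith [norm_nonneg (z : ℂ), Disc.norm_lt_one z]
  set u : Disc → ENNReal := fun z => ENNReal.ofReal ((1 - ‖(z : ℂ)‖ ^ 2) ^ (-(1 / (p * q))))
  -- The exponent `1/(p q)` is chosen so that `u^p` and `u^q` carry the exponents `-1/q` and `-1/p`,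
  -- both in the range `0 < s < 1` of the kernel estimate.
  have hup : ∀ z, u z ^ p = ENNReal.ofReal ((1 - ‖(z : ℂ)‖ ^ 2) ^ (-(1 / q))) := fun z => by
    rw [ENNReal.ofReal_rpow_of_nonneg (Real.rpow_nonneg (hpos z).le _) hp.le,
      ← Real.rpow_mul (hpos z).le]
    congr 2
    field_simp
  have huq : ∀ z, u z ^ q = ENNReal.ofReal ((1 - ‖(z : ℂ)‖ ^ 2) ^ (-(1 / p))) := fun z => by
    rw [ENNReal.ofReal_rpow_of_nonneg (Real.rpow_nonneg (hpos z).le _) hq.le,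
      ← Real.rpow_mul (hpos z).le]
    congr 2
    field_simp
  have main : ∀ s : ℝ, 0 < s → s < 1 → ∀ z : Disc,
      ∫⁻ w : Disc, absKernel z w * ENNReal.ofReal ((1 - ‖(w : ℂ)‖ ^ 2) ^ (-s)) ∂σ ≤
        ENNReal.ofReal (1 / s + 1 / (1 - s)) * ENNReal.ofReal ((1 - ‖(z : ℂ)‖ ^ 2) ^ (-s)) := by
    intro s h0 h1 z
    simpa only [absKernel, mul_comm] using lintegral_rpow_mul_kernel_le h0 h1 z
  refine ⟨_, ?_, fun f hf => lintegral_schur (A := ENNReal.ofReal (1 / (1 / q) + 1 / (1 - 1 / q)))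
    (B := ENNReal.ofReal (1 / (1 / p) + 1 / (1 - 1 / p))) hpq measurable_uncurry_absKernel (u := u)
    (by fun_prop) (fun z => ?_) (fun z => ENNReal.ofReal_ne_top) (fun z => ?_) (fun z => ?_) hf⟩
  · exact ENNReal.mul_ne_top (ENNReal.rpow_ne_top_of_nonneg (by positivity) ENNReal.ofReal_ne_top)
      ENNReal.ofReal_ne_top
  · exact (ENNReal.ofReal_pos.2 (Real.rpow_pos_of_pos (hpos z) _)).ne'
  · simp only [hup]
    exact main (1 / q) (by positivity) ((div_lt_one hq).2 hq1) z
  · simp only [huq, absKernel_comm _ z]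
    exact main (1 / p) (by positivity) ((div_lt_one hp).2 hp1) z

theorem isAnalytic_proj {f : Disc → ℂ} (hf : Integrable f σ) : IsAnalytic (proj f) := by
  refine ⟨fun z => ∫ ζ : Disc, f ζ / (1 - starRingEnd ℂ (ζ : ℂ) * z) ^ 2 ∂σ, ?_, fun z => rfl⟩
  intro z₀ hz₀
  rw [mem_ball_zero_iff] at hz₀
  -- Half the distance from `z₀` to the unit circle: on the ball of this radius the denominators are
  -- bounded below uniformly in `ζ`, which permits differentiation under the integral.
  set d := (1 - ‖z₀‖) / 2 with hd
  have hd0 : 0 < d := by rw [hd]; linarith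
  have hle : ∀ (w : Disc), ∀ z ∈ Metric.ball z₀ d, d ≤ ‖1 - starRingEnd ℂ (w : ℂ) * z‖ := by
    intro w z hz
    refine le_trans ?_ (one_sub_norm_le_norm_one_sub_conj_mul w z)
    have := norm_sub_norm_le z z₀
    rw [mem_ball_iff_norm] at hz
    linarith
  have hmeas : ∀ z : ℂ, AEStronglyMeasurable
      (fun ζ : Disc => f ζ / (1 - starRingEnd ℂ (ζ : ℂ) * z) ^ 2) σ := fun z => by
    have : Measurable fun ζ : Disc => ((1 - starRingEnd ℂ (ζ : ℂ) * z) ^ 2)⁻¹ := by fun_prop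
    exact hf.aestronglyMeasurable.mul this.aestronglyMeasurable
  refine (hasDerivAt_integral_of_dominated_loc_of_deriv_le
    (F' := fun z ζ => f ζ * (2 * starRingEnd ℂ (ζ : ℂ) / (1 - starRingEnd ℂ (ζ : ℂ) * z) ^ 3))
    (bound := fun ζ => ‖f ζ‖ * (2 / d ^ 3)) (Metric.ball_mem_nhds z₀ hd0)
    (Filter.Eventually.of_forall hmeas) ?_ ?_ (ae_of_all _ fun ζ z hz => ?_)
    (hf.norm.mul_const _) (ae_of_all _ fun ζ z hz => ?_)).2.differentiableAt.differentiableWithinAt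
  · refine Integrable.mono' (hf.norm.mul_const (1 / d ^ 2)) (hmeas z₀) (ae_of_all _ fun ζ => ?_)
    rw [norm_div, norm_pow, div_eq_mul_one_div]
    have := hle ζ z₀ (Metric.mem_ball_self hd0)
    gcongr
  · have : Measurable fun ζ : Disc =>
      2 * starRingEnd ℂ (ζ : ℂ) / (1 - starRingEnd ℂ (ζ : ℂ) * z₀) ^ 3 := by fun_prop
    exact hf.aestronglyMeasurable.mul this.aestronglyMeasurable
  · have h1 := hle ζ z hz
    have h2 : ‖2 * starRingEnd ℂ (ζ : ℂ)‖ ≤ 2 := by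
      rw [norm_mul, RCLike.norm_conj, RCLike.norm_ofNat]
      linarith [Disc.norm_lt_one ζ]
    rw [norm_mul, norm_div, norm_pow]
    gcongr
  · have h0 : 1 - starRingEnd ℂ (ζ : ℂ) * z ≠ 0 := norm_pos_iff.1 (hd0.trans_le (hle ζ z hz))
    have h1 : HasDerivAt (fun z : ℂ => 1 - starRingEnd ℂ (ζ : ℂ) * z) (-starRingEnd ℂ (ζ : ℂ)) z := by
      simpa using ((hasDerivAt_id z).const_mul (starRingEnd ℂ (ζ : ℂ))).const_sub 1
    have h2 := (h1.pow 2).inv (pow_ne_zero 2 h0)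
    refine (h2.const_mul (f ζ)).congr_deriv ?_
    simp only [Pi.pow_apply]
    field_simp
    ring

theorem memLp_proj {p q : ℝ} (hpq : p.HolderConjugate q) {f : Disc → ℂ} (hf : Measurable f)
    (hfq : MemLp f (ENNReal.ofReal q) σ) : MemLp (proj f) (ENNReal.ofReal q) σ := by
  have hq := hpq.symm.pos
  have hq0 : ENNReal.ofReal q ≠ 0 := by simpa using hq
  have hint : Integrable f σ := hfq.integrable (by simpa using hpq.symm.lt.le)
  refine ⟨(isAnalytic_proj hint).continuous.aestronglyMeasurable, ?_⟩
  obtain ⟨C, hC, hle⟩ := exists_lintegral_absKernel_rpow_le hpq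
  have hfin := hfq.2
  rw [eLpNorm_lt_top_iff_lintegral_rpow_enorm_lt_top hq0 ENNReal.ofReal_ne_top,
    ENNReal.toReal_ofReal hq.le] at hfin ⊢
  refine lt_of_le_of_lt (lintegral_mono fun z => ?_)
    ((hle (fun w => ‖f w‖ₑ) hf.enorm).trans_lt (ENNReal.mul_lt_top hC.lt_top hfin))
  gcongr
  refine (enorm_integral_le_lintegral_enorm _).trans_eq ?_
  simp only [enorm_div_kernel]

/-! ### Reproducing property and invariance of functionals under the projection -/

/-- Again `w (1 - conj w * z) = w - t z` on the circle. Together with the factor `1/w` of the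
average this turns the integrand into `w G(w) / (w - t z)^2`, and Cauchy's formula for the
derivative applies. -/
theorem circleAverage_kernel {G : ℂ → ℂ} (hG : DifferentiableOn ℂ G (Metric.ball 0 1)) {z : ℂ}
    (hz : ‖z‖ < 1) {t : ℝ} (ht0 : 0 < t) (ht1 : t < 1) :
    Real.circleAverage (fun w => G w / (1 - starRingEnd ℂ w * z) ^ 2) 0 √t
      = deriv (fun w => w * G w) (t * z) := by
  have ht : √t < 1 := by rw [Real.sqrt_lt' one_pos]; simpa using ht1
  have hpos : 0 < √t := Real.sqrt_pos.2 ht0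
  have hball : (t * z : ℂ) ∈ Metric.ball 0 √t := by
    rw [mem_ball_zero_iff, norm_mul, Complex.norm_real, Real.norm_eq_abs, abs_of_pos ht0]
    nlinarith [Real.sq_sqrt ht0.le, norm_nonneg z]
  rw [Real.circleAverage_eq_circleIntegral hpos.ne',
    ← Complex.two_pi_I_inv_smul_circleIntegral_sub_sq_inv_smul_of_differentiable
      (f := fun w => w * G w) (U := Metric.ball 0 1) Metric.isOpen_ball (Metric.closedBall_subset_ball ht)
      (differentiableOn_id.mul hG) hball]
  congr 1
  refine circleIntegral.integral_congr hpos.le fun w hw => ?_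
  rw [mem_sphere_zero_iff_norm] at hw
  have hw0 : w ≠ 0 := norm_pos_iff.1 (hw ▸ hpos)
  have h1 : w - t * z = w * (1 - starRingEnd ℂ w * z) := by
    rw [mul_sub, ← mul_assoc, Complex.mul_conj', hw, ← Complex.ofReal_pow, Real.sq_sqrt ht0.le,
      mul_one]
  have h2 := one_sub_conj_mul_ne_zero (hw ▸ ht) hz
  simp only [sub_zero, smul_eq_mul]
  rw [h1]
  field_simp

theorem integrable_div_kernel {f : Disc → ℂ} (hf : Integrable f σ) (z : Disc) :
    Integrable (fun ζ : Disc => f ζ / (1 - starRingEnd ℂ (ζ : ℂ) * (z : ℂ)) ^ 2) σ := by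
  have hz : 0 < 1 - ‖(z : ℂ)‖ := sub_pos.2 (Disc.norm_lt_one z)
  have : Measurable fun ζ : Disc => ((1 - starRingEnd ℂ (ζ : ℂ) * z) ^ 2)⁻¹ := by fun_prop
  refine Integrable.mono' (hf.norm.mul_const (1 / (1 - ‖(z : ℂ)‖) ^ 2))
    (hf.aestronglyMeasurable.mul this.aestronglyMeasurable) (ae_of_all _ fun ζ => ?_)
  rw [norm_div, norm_pow, div_eq_mul_one_div]
  have := one_sub_norm_le_norm_one_sub_conj_mul ζ z
  gcongr

/-- The reproducing property of the Bergman kernel. -/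
theorem proj_eq_self {f : Disc → ℂ} (hf : IsAnalytic f) (hi : Integrable f σ) (z : Disc) :
    proj f z = f z := by
  obtain ⟨G, hG, hGf⟩ := hf
  have hz := Disc.norm_lt_one z
  have hHd : DifferentiableOn ℂ (fun w => w * G w) (Metric.ball 0 1) := differentiableOn_id.mul hG
  have hmem : ∀ t ∈ Set.Icc (0 : ℝ) 1, (t * z : ℂ) ∈ Metric.ball 0 1 := fun t ht => by
    rw [mem_ball_zero_iff, norm_mul, Complex.norm_real, Real.norm_eq_abs, abs_of_nonneg ht.1]
    nlinarith [norm_nonneg (z : ℂ), ht.2]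
  -- Extension by zero: `G` is arbitrary off the disc, while the polar formula needs a measurable
  -- function on the whole plane.
  set k : ℂ → ℂ := (Metric.ball 0 1).indicator fun w => G w / (1 - starRingEnd ℂ w * z) ^ 2
  have hk : ∀ w : Disc, k w = f w / (1 - starRingEnd ℂ (w : ℂ) * z) ^ 2 := fun w => by
    rw [← hGf w]; exact Set.indicator_of_mem w.2 _
  have hkm : Measurable k := by
    have hc : ContinuousOn (fun w => G w / (1 - starRingEnd ℂ w * z) ^ 2) (Metric.ball 0 1) :=
      hG.continuousOn.div (by fun_prop) fun w hw =>
        pow_ne_zero 2 (one_sub_conj_mul_ne_zero (mem_ball_zero_iff.1 hw) hz)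
    classical
    rw [show k = (Metric.ball 0 1).piecewise _ (0 : ℂ → ℂ) from (Set.piecewise_eq_indicator).symm]
    exact hc.measurable_piecewise continuousOn_const measurableSet_ball
  have hki : Integrable (fun w : Disc => k w) σ := by
    simp only [hk]; exact integrable_div_kernel hi z
  have h1 : proj f z = ∫ t in Set.Ioo (0 : ℝ) 1, deriv (fun w => w * G w) (t * z) := by
    have : proj f z = ∫ w : Disc, k w ∂σ := by simp only [proj, hk]
    rw [this, integral_σ_eq_polar hkm hki]
    refine setIntegral_congr_fun measurableSet_Ioo fun t ht => ?_
    rw [integral_angleMeasure_eq_circleAverage, ← circleAverage_kernel hG hz ht.1 ht.2]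
    refine Real.circleAverage_congr_sphere fun w hw => Set.indicator_of_mem ?_ _
    rw [mem_sphere_zero_iff_norm, abs_of_nonneg (Real.sqrt_nonneg t)] at hw
    rw [mem_ball_zero_iff, hw, Real.sqrt_lt' one_pos]
    simpa using ht.2
  -- The radial integrand is the exact derivative of `t G(t z)`, so the integral equals the value
  -- `G(z)` at `t = 1`.
  have hda : ∀ t ∈ Set.Icc (0 : ℝ) 1,
      HasDerivAt (fun t : ℝ => (t : ℂ) * G (t * z)) (deriv (fun w => w * G w) (t * z)) t := by
    intro t ht
    have hGd := (hG.differentiableAt (Metric.isOpen_ball.mem_nhds (hmem t ht))).hasDerivAt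
    have h2 : HasDerivAt (fun t : ℝ => (t : ℂ) * z) z t := by
      simpa using (Complex.ofRealCLM.hasDerivAt (x := t)).mul_const (z : ℂ)
    have h3 := (Complex.ofRealCLM.hasDerivAt (x := t)).mul (hGd.comp t h2)
    refine h3.congr_deriv ?_
    rw [((hasDerivAt_id' _).fun_mul hGd).deriv]
    simp
    ring
  rw [h1, ← integral_Ioc_eq_integral_Ioo, ← intervalIntegral.integral_of_le zero_le_one,
    intervalIntegral.integral_eq_sub_of_hasDerivAt (f := fun t : ℝ => (t : ℂ) * G (t * z))]
  · simp [hGf]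
  · intro t ht
    rw [Set.uIcc_of_le zero_le_one] at ht
    exact hda t ht
  · refine ContinuousOn.intervalIntegrable ?_
    rw [Set.uIcc_of_le zero_le_one]
    exact (hHd.deriv Metric.isOpen_ball).continuousOn.comp (by fun_prop) hmem

theorem integral_mul_conj_integrable {p q : ℝ} (hpq : p.HolderConjugate q) {f h : Disc → ℂ}
    (hf : MemLp f (ENNReal.ofReal p) σ) (hh : MemLp h (ENNReal.ofReal q) σ) :
    Integrable (fun z => f z * starRingEnd ℂ (h z)) σ := by
  have := hpq.ennrealOfReal
  exact hf.integrable_mul hh.star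

/-- The Bergman projection does not change the functional represented by a function. -/
theorem integral_mul_conj_proj {p q : ℝ} (hpq : p.HolderConjugate q) (f : Space p) {h : Disc → ℂ}
    (hm : Measurable h) (hh : MemLp h (ENNReal.ofReal q) σ) :
    ∫ z, f z * starRingEnd ℂ (proj h z) ∂σ = ∫ z, f z * starRingEnd ℂ (h z) ∂σ := by
  have hp := hpq.pos
  have hq := hpq.symm.pos
  have hfm : Measurable (f : Disc → ℂ) := f.isAnalytic.continuous.measurable
  have hfi : Integrable (f : Disc → ℂ) σ := f.memLp.integrable (by simpa using hpq.lt.le)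
  set k : Disc → Disc → ℂ := fun z w =>
    f z * starRingEnd ℂ (h w / (1 - starRingEnd ℂ (w : ℂ) * z) ^ 2) with hk
  have hkm : Measurable (Function.uncurry k) := by
    simp only [hk, Function.uncurry_def]
    fun_prop
  have hknorm : ∀ z w, ‖k z w‖ₑ = ‖f z‖ₑ * (absKernel z w * ‖h w‖ₑ) := fun z w => by
    rw [hk]
    simp only
    rw [enorm_mul, RCLike.enorm_conj, enorm_div_kernel]
  have hKm : Measurable fun z => ∫⁻ w, absKernel z w * ‖h w‖ₑ ∂σ :=
    Measurable.lintegral_prod_right' (f := fun x : Disc × Disc => absKernel x.1 x.2 * ‖h x.2‖ₑ)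
      (measurable_uncurry_absKernel.mul (hm.comp measurable_snd).enorm)
  -- Fubini needs absolute integrability: Hölder pairs `f` in `L^p` with the integral of `|h|`
  -- against the absolute kernel, which is in `L^q` by Schur's test.
  have hki : Integrable (Function.uncurry k) (σ.prod σ) := by
    refine ⟨hkm.aestronglyMeasurable, ?_⟩
    rw [HasFiniteIntegral, lintegral_prod _ hkm.enorm.aemeasurable]
    obtain ⟨C, hC, hle⟩ := exists_lintegral_absKernel_rpow_le hpq
    have h1 := f.memLp.2
    have h2 := hh.2
    rw [eLpNorm_lt_top_iff_lintegral_rpow_enorm_lt_top (by simpa using hp) ENNReal.ofReal_ne_top,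
      ENNReal.toReal_ofReal hp.le] at h1
    rw [eLpNorm_lt_top_iff_lintegral_rpow_enorm_lt_top (by simpa using hq) ENNReal.ofReal_ne_top,
      ENNReal.toReal_ofReal hq.le] at h2
    have h3 := (hle (fun w => ‖h w‖ₑ) hm.enorm).trans_lt (ENNReal.mul_lt_top hC.lt_top h2)
    have h4 := ENNReal.lintegral_mul_le_Lp_mul_Lq σ hpq hfm.enorm.aemeasurable hKm.aemeasurable
    refine lt_of_eq_of_lt (lintegral_congr fun z => ?_) (h4.trans_lt
      (ENNReal.mul_lt_top (ENNReal.rpow_lt_top_of_nonneg (by positivity) h1.ne)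
        (ENNReal.rpow_lt_top_of_nonneg (by positivity) h3.ne)))
    simp only [Function.uncurry_apply_pair, hknorm, Pi.mul_apply]
    rw [lintegral_const_mul' _ _ enorm_ne_top]
  have hswap := integral_integral_swap hki
  have hl : ∀ z, ∫ w, k z w ∂σ = f z * starRingEnd ℂ (proj h z) := fun z => by
    rw [hk, proj, ← integral_conj, integral_const_mul]
  -- Conjugation exchanges the two variables of the kernel, so the inner integral in `z` reproduces
  -- `f w`.
  have hr : ∀ w, ∫ z, k z w ∂σ = f w * starRingEnd ℂ (h w) := fun w => by
    have : ∀ z, k z w = starRingEnd ℂ (h w) *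
        (f z / (1 - starRingEnd ℂ (z : ℂ) * w) ^ 2) := fun z => by
      simp only [hk, map_div₀, map_pow, map_sub, map_one, map_mul, Complex.conj_conj]
      rw [mul_comm (w : ℂ)]
      ring
    simp only [this]
    rw [integral_const_mul, ← proj, proj_eq_self f.isAnalytic hfi, mul_comm]
  simpa only [hl, hr] using hswap

/-- The functional on `A^p` represented by a function in `L^q`. -/
def functional {p q : ℝ} [Fact (1 < p)] (hpq : p.HolderConjugate q) {h : Disc → ℂ}
    (hh : MemLp h (ENNReal.ofReal q) σ) : Space p →L[ℂ] ℂ :=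
  LinearMap.mkContinuous
    { toFun := fun f => ∫ z, f z * starRingEnd ℂ (h z) ∂σ
      map_add' := fun f g => by
        simp only [map_add, Pi.add_apply, add_mul]
        exact integral_add (integral_mul_conj_integrable hpq f.memLp hh)
          (integral_mul_conj_integrable hpq g.memLp hh)
      map_smul' := fun c f => by
        simp only [map_smul, Pi.smul_apply, smul_eq_mul, mul_assoc, RingHom.id_apply]
        exact integral_const_mul _ _ }
    ((∫ z, ‖h z‖ ^ q ∂σ) ^ (1 / q)) (fun f => by
      rw [norm_eq, mul_comm]
      refine (norm_integral_le_integral_norm _).trans ?_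
      simp only [norm_mul, RCLike.norm_conj]
      exact integral_mul_norm_le_Lp_mul_Lq hpq f.memLp hh)

theorem functional_apply {p q : ℝ} [Fact (1 < p)] (hpq : p.HolderConjugate q) {h : Disc → ℂ}
    (hh : MemLp h (ENNReal.ofReal q) σ) (f : Space p) :
    functional hpq hh f = ∫ z, f z * starRingEnd ℂ (h z) ∂σ := rfl

theorem norm_functional_le {p q : ℝ} [Fact (1 < p)] (hpq : p.HolderConjugate q) {h : Disc → ℂ}
    (hh : MemLp h (ENNReal.ofReal q) σ) :
    ‖functional hpq hh‖ ≤ (∫ z, ‖h z‖ ^ q ∂σ) ^ (1 / q) :=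
  LinearMap.mkContinuous_norm_le _
    (Real.rpow_nonneg (integral_nonneg fun _ => Real.rpow_nonneg (norm_nonneg _) _) _) _

/-! ### The duality map and the strict convexity inequality -/

/-- The duality map `w ↦ |w|^(p-1) sgn w`. -/
def dualMap (p : ℝ) (w : ℂ) : ℂ := ((‖w‖ ^ (p - 1) : ℝ) : ℂ) * sgn w

theorem dualFun_apply (p : ℝ) (F : Disc → ℂ) (z : Disc) : dualFun p F z = dualMap p (F z) := rfl

theorem norm_dualMap {p : ℝ} (hp : 1 < p) (w : ℂ) : ‖dualMap p w‖ = ‖w‖ ^ (p - 1) := by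
  rcases eq_or_ne w 0 with rfl | hw
  · simp [dualMap, sgn, Real.zero_rpow (sub_ne_zero.2 hp.ne')]
  · have : ‖w‖ ≠ 0 := norm_ne_zero_iff.2 hw
    rw [dualMap, sgn, norm_mul, norm_div, Complex.norm_real, Complex.norm_real, norm_norm,
      div_self this, mul_one, Real.norm_of_nonneg (Real.rpow_nonneg (norm_nonneg _) _)]

theorem continuous_dualMap {p : ℝ} (hp : 1 < p) : Continuous (dualMap p) := by
  refine continuous_iff_continuousAt.2 fun w => ?_
  rcases eq_or_ne w 0 with rfl | hw
  · have h0 : dualMap p 0 = 0 := by simp [dualMap, sgn]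
    rw [ContinuousAt, h0, tendsto_zero_iff_norm_tendsto_zero]
    simp only [norm_dualMap hp]
    have : Continuous fun w : ℂ => ‖w‖ ^ (p - 1) :=
      continuous_norm.rpow_const fun _ => Or.inr (sub_nonneg.2 hp.le)
    simpa [Real.zero_rpow (sub_ne_zero.2 hp.ne')] using this.tendsto 0
  · have hn : ‖w‖ ≠ 0 := norm_ne_zero_iff.2 hw
    unfold dualMap sgn
    refine ContinuousAt.mul ?_ ?_
    · exact Complex.continuous_ofReal.continuousAt.comp
        (continuous_norm.continuousAt.rpow_const (Or.inl hn))
    · exact continuousAt_id.div (by fun_prop) (by exact_mod_cast hn)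

theorem mul_conj_dualMap_self {p : ℝ} (hp : 1 < p) (w : ℂ) :
    w * starRingEnd ℂ (dualMap p w) = ((‖w‖ ^ p : ℝ) : ℂ) := by
  rcases eq_or_ne w 0 with rfl | hw
  · simp [Real.zero_rpow (zero_lt_one.trans hp).ne']
  · have hn : ‖w‖ ≠ 0 := norm_ne_zero_iff.2 hw
    have hn' : (‖w‖ : ℂ) ≠ 0 := by exact_mod_cast hn
    rw [dualMap, sgn, map_mul, map_div₀, Complex.conj_ofReal, Complex.conj_ofReal,
      Real.rpow_sub_one hn]
    push_cast
    have := Complex.mul_conj' w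
    field_simp
    rw [mul_right_comm, this, mul_comm]

/-- The graph of `x ^ p` lies strictly above its tangent at `y`; for `y > 0` this is Bernoulli's
inequality with `s = x / y - 1`, scaled by `y ^ p`. -/
theorem rpow_add_mul_lt_rpow {p x y : ℝ} (hp : 1 < p) (hx : 0 ≤ x) (hy : 0 ≤ y) (hxy : x ≠ y) :
    y ^ p + p * (y ^ (p - 1) * (x - y)) < x ^ p := by
  rcases hy.eq_or_lt with rfl | hy
  · rw [Real.zero_rpow (zero_lt_one.trans hp).ne', Real.zero_rpow (sub_ne_zero.2 hp.ne')]
    simpa using Real.rpow_pos_of_pos (hx.lt_of_ne hxy.symm) p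
  · have h1 := one_add_mul_self_lt_rpow_one_add (s := x / y - 1) (by have := div_nonneg hx hy.le; linarith)
      (by rwa [sub_ne_zero, Ne, div_eq_one_iff_eq hy.ne']) hp
    rw [add_sub_cancel, Real.div_rpow hx hy.le, lt_div_iff₀ (Real.rpow_pos_of_pos hy p)] at h1
    refine lt_of_eq_of_lt ?_ h1
    rw [Real.rpow_sub_one hy.ne']
    field_simp

/-- If the moduli differ, strictness comes from the real tangent inequality. If they agree, it comes
from the argument: `|b - a|^2 > 0` makes `Re (b conj a) < |a|^2`. -/
theorem norm_rpow_add_mul_lt {p : ℝ} (hp : 1 < p) {a b : ℂ} (hab : a ≠ b) :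
    ‖a‖ ^ p + p * ((b - a) * starRingEnd ℂ (dualMap p a)).re < ‖b‖ ^ p := by
  have hp0 : 0 < p := zero_lt_one.trans hp
  have hsub : ((b - a) * starRingEnd ℂ (dualMap p a)).re
      = (b * starRingEnd ℂ (dualMap p a)).re - ‖a‖ ^ p := by
    rw [sub_mul, mul_conj_dualMap_self hp, Complex.sub_re, Complex.ofReal_re]
  by_cases hn : ‖b‖ = ‖a‖
  · have ha : ‖a‖ ≠ 0 := by
      intro h
      rw [h] at hn
      exact hab ((norm_eq_zero.1 h).trans (norm_eq_zero.1 hn).symm)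
    have hpos : 0 < ‖a‖ := (norm_nonneg a).lt_of_ne ha.symm
    have h1 : b * starRingEnd ℂ (dualMap p a)
        = ((‖a‖ ^ (p - 1) / ‖a‖ : ℝ) : ℂ) * (b * starRingEnd ℂ a) := by
      rw [dualMap, sgn, map_mul, map_div₀, Complex.conj_ofReal, Complex.conj_ofReal]
      push_cast
      ring
    have h2 : (b * starRingEnd ℂ a).re < ‖a‖ ^ 2 := by
      have h3 : 0 < Complex.normSq (b - a) := Complex.normSq_pos.2 (sub_ne_zero.2 hab.symm)
      rw [Complex.normSq_sub, Complex.normSq_eq_norm_sq, Complex.normSq_eq_norm_sq, hn] at h3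
      linarith
    have h4 : (b * starRingEnd ℂ (dualMap p a)).re < ‖a‖ ^ p := by
      rw [h1, Complex.re_ofReal_mul]
      calc ‖a‖ ^ (p - 1) / ‖a‖ * (b * starRingEnd ℂ a).re
          < ‖a‖ ^ (p - 1) / ‖a‖ * ‖a‖ ^ 2 := by
            have := Real.rpow_pos_of_pos hpos (p - 1)
            gcongr
        _ = ‖a‖ ^ p := by rw [Real.rpow_sub_one ha]; field_simp
    rw [hsub, hn]
    nlinarith
  · refine lt_of_le_of_lt ?_ (rpow_add_mul_lt_rpow hp (norm_nonneg b) (norm_nonneg a) hn)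
    rw [hsub]
    gcongr
    have h1 : (b * starRingEnd ℂ (dualMap p a)).re ≤ ‖b‖ * ‖a‖ ^ (p - 1) := by
      refine (Complex.re_le_norm _).trans_eq ?_
      rw [norm_mul, RCLike.norm_conj, norm_dualMap hp]
    have h2 : ‖a‖ ^ (p - 1) * ‖a‖ = ‖a‖ ^ p := by
      rw [← Real.rpow_add_one' (norm_nonneg _) (by linarith), sub_add_cancel]
    linarith

theorem norm_rpow_add_mul_le {p : ℝ} (hp : 1 < p) (a b : ℂ) :
    ‖a‖ ^ p + p * ((b - a) * starRingEnd ℂ (dualMap p a)).re ≤ ‖b‖ ^ p := by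
  rcases eq_or_ne a b with rfl | h
  · simp
  · exact (norm_rpow_add_mul_lt hp h).le

variable {p q : ℝ}

theorem memLp_dualMap_comp (hpq : p.HolderConjugate q) {f : Disc → ℂ}
    (hf : MemLp f (ENNReal.ofReal p) σ) :
    MemLp (fun z => dualMap p (f z)) (ENNReal.ofReal q) σ := by
  have h := hf.norm_rpow_div (ENNReal.ofReal (p - 1))
  rw [← ENNReal.ofReal_div_of_pos hpq.sub_one_pos, ← hpq.conjugate_eq,
    ENNReal.toReal_ofReal hpq.sub_one_pos.le] at h
  refine h.congr_norm ((continuous_dualMap hpq.lt).comp_aestronglyMeasurable hf.1)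
    (ae_of_all _ fun z => ?_)
  rw [norm_dualMap hpq.lt, Real.norm_of_nonneg (Real.rpow_nonneg (norm_nonneg _) _)]

theorem memLp_dualFun (hpq : p.HolderConjugate q) (F : Space p) :
    MemLp (dualFun p F) (ENNReal.ofReal q) σ :=
  memLp_dualMap_comp hpq F.memLp

theorem continuous_dualFun (hp : 1 < p) (F : Space p) : Continuous (dualFun p F) :=
  (continuous_dualMap hp).comp F.isAnalytic.continuous

theorem norm_rpow_eq [Fact (1 < p)] (f : Space p) : ‖f‖ ^ p = ∫ z, ‖f z‖ ^ p ∂σ := by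
  have hp : p ≠ 0 := (zero_lt_one.trans Fact.out).ne'
  rw [norm_eq, ← Real.rpow_mul (integral_nonneg fun _ => Real.rpow_nonneg (norm_nonneg _) _),
    one_div_mul_cancel hp, Real.rpow_one]

theorem integrable_norm_rpow (hp : 0 < p) (f : Space p) :
    Integrable (fun z => ‖f z‖ ^ p) σ := by
  simpa [ENNReal.toReal_ofReal hp.le] using f.memLp.integrable_norm_rpow'

theorem integrable_mul_conj_dualFun (hpq : p.HolderConjugate q) (f F : Space p) :
    Integrable (fun z => f z * starRingEnd ℂ (dualFun p F z)) σ :=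
  integral_mul_conj_integrable hpq f.memLp (memLp_dualFun hpq F)

theorem integral_mul_conj_dualFun_self [Fact (1 < p)] (F : Space p) :
    ∫ z, F z * starRingEnd ℂ (dualFun p F z) ∂σ = ((‖F‖ ^ p : ℝ) : ℂ) := by
  rw [norm_rpow_eq, ← integral_complex_ofReal]
  exact integral_congr_ae (ae_of_all _ fun z => mul_conj_dualMap_self Fact.out _)

theorem integral_norm_dualFun_rpow [Fact (1 < p)] (hpq : p.HolderConjugate q) (F : Space p) :
    ∫ z, ‖dualFun p F z‖ ^ q ∂σ = ‖F‖ ^ p := by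
  rw [norm_rpow_eq]
  refine integral_congr_ae (ae_of_all _ fun z => ?_)
  simp only [dualFun_apply, norm_dualMap hpq.lt]
  rw [← Real.rpow_mul (norm_nonneg _), hpq.sub_one_mul_conj]

theorem norm_rpow_add_re_integral_le [Fact (1 < p)] (hpq : p.HolderConjugate q) (F G : Space p) :
    ‖F‖ ^ p + p * (∫ z, (G - F) z * starRingEnd ℂ (dualFun p F z) ∂σ).re ≤ ‖G‖ ^ p := by
  have hi := integrable_mul_conj_dualFun hpq (G - F) F
  rw [norm_rpow_eq, norm_rpow_eq, ← RCLike.re_eq_complex_re, ← integral_re hi,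
    ← integral_const_mul, ← integral_add (integrable_norm_rpow hpq.pos F) (hi.re.const_mul p)]
  refine integral_mono ((integrable_norm_rpow hpq.pos F).add (hi.re.const_mul p))
    (integrable_norm_rpow hpq.pos G) fun z => ?_
  simp only [map_sub, Pi.sub_apply]
  exact norm_rpow_add_mul_le hpq.lt _ _

/-- Equality of the integrals forces pointwise equality almost everywhere, where strictness gives `F
z = G z`; continuity extends this to every point. -/
theorem eq_of_norm_rpow_add_re_integral_eq [Fact (1 < p)] (hpq : p.HolderConjugate q)
    {F G : Space p}
    (h : ‖F‖ ^ p + p * (∫ z, (G - F) z * starRingEnd ℂ (dualFun p F z) ∂σ).re = ‖G‖ ^ p) :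
    F = G := by
  have hi := integrable_mul_conj_dualFun hpq (G - F) F
  rw [norm_rpow_eq, norm_rpow_eq, ← RCLike.re_eq_complex_re, ← integral_re hi,
    ← integral_const_mul, ← integral_add (integrable_norm_rpow hpq.pos F) (hi.re.const_mul p)] at h
  replace h := (integral_eq_iff_of_ae_le
    ((integrable_norm_rpow hpq.pos F).add (hi.re.const_mul p))
    (integrable_norm_rpow hpq.pos G) (ae_of_all _ fun z => by
      simp only [map_sub, Pi.add_apply, Pi.sub_apply]
      exact norm_rpow_add_mul_le hpq.lt _ _)).1 h
  refine Space.ext ((Continuous.ae_eq_iff_eq σ F.isAnalytic.continuous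
    G.isAnalytic.continuous).1 ?_)
  filter_upwards [h] with z hz
  by_contra hne
  simp only [map_sub, Pi.add_apply, Pi.sub_apply] at hz
  exact (norm_rpow_add_mul_lt hpq.lt hne).ne hz

/-! ### Extremality and uniqueness -/

/-- Hölder bounds the norm by the `L^q` norm of `J F`, which is one, and the value at `F` is `‖F‖ ^
p = 1`. -/
theorem isExtremal_functional_dualFun [Fact (1 < p)] (hpq : p.HolderConjugate q) {F : Space p}
    (hF : ‖F‖ = 1) : IsExtremal (functional hpq (memLp_dualFun hpq F)) F := by
  set φ := functional hpq (memLp_dualFun hpq F) with hφ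
  have h1 : φ F = 1 := by
    rw [hφ, functional_apply, integral_mul_conj_dualFun_self, hF, Real.one_rpow, Complex.ofReal_one]
  have h2 : ‖φ‖ ≤ 1 := by
    refine (norm_functional_le hpq _).trans_eq ?_
    rw [integral_norm_dualFun_rpow hpq, hF, Real.one_rpow, Real.one_rpow]
  have hle : ∀ g : Space p, ‖g‖ = 1 → (φ g).re ≤ 1 := fun g hg =>
    (Complex.re_le_norm _).trans ((φ.le_of_opNorm_le h2 g).trans_eq (by rw [hg, one_mul]))
  have h3 : ‖φ‖ = 1 := by
    refine le_antisymm h2 ?_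
    simpa [h1, hF] using φ.le_opNorm F
  refine ⟨fun h => ?_, hF, ⟨?_, ?_⟩, ?_⟩
  · rw [h] at h1
    simp at h1
  · rintro t ⟨g, hg, rfl⟩
    simpa [h1] using hle g hg
  · intro b hb
    exact hb ⟨F, hF, rfl⟩
  · rw [h1, h3, Complex.one_re]

theorem eq_of_isExtremal_functional_dualFun [Fact (1 < p)] (hpq : p.HolderConjugate q)
    {F G : Space p} (hF : ‖F‖ = 1) (hG : IsExtremal (functional hpq (memLp_dualFun hpq F)) G) :
    G = F := by
  have h1 := (isExtremal_functional_dualFun hpq hF).eq_norm.trans hG.eq_norm.symm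
  refine (eq_of_norm_rpow_add_re_integral_eq hpq ?_).symm
  rw [← functional_apply hpq (memLp_dualFun hpq F), map_sub, Complex.sub_re, ← h1, hF,
    hG.norm_eq_one, sub_self, mul_zero, add_zero]

/-! ### The variational argument for a given extremal function -/

/-- Dominated convergence: the step sizes are at most one, so `|f| (|F| + |f|)^(p-1)` is a majorant,
integrable by Hölder. -/
theorem tendsto_integral_mul_conj_dualFun (hpq : p.HolderConjugate q) (F f : Space p) :
    Filter.Tendsto (fun n : ℕ => ∫ z, f z * starRingEnd ℂ
        (dualFun p (F + ((1 / ((n : ℝ) + 1) : ℝ) : ℂ) • f : Space p) z) ∂σ) Filter.atTop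
      (nhds (∫ z, f z * starRingEnd ℂ (dualFun p F z) ∂σ)) := by
  have hp := hpq.lt
  have hbound : MemLp (fun z => ((‖F z‖ + ‖f z‖ : ℝ) : ℂ)) (ENNReal.ofReal p) σ :=
    (F.memLp.norm.add f.memLp.norm).ofReal
  refine tendsto_integral_of_dominated_convergence
    (fun z => ‖f z‖ * ‖dualMap p ((‖F z‖ + ‖f z‖ : ℝ) : ℂ)‖) (fun n => ?_) ?_
    (fun n => ae_of_all _ fun z => ?_) (ae_of_all _ fun z => ?_)
  · exact (integrable_mul_conj_dualFun hpq f _).aestronglyMeasurable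
  · have := integral_mul_conj_integrable hpq f.memLp (memLp_dualMap_comp hpq hbound)
    simpa only [norm_mul, RCLike.norm_conj] using this.norm
  · rw [norm_mul, RCLike.norm_conj, dualFun_apply, norm_dualMap hp, norm_dualMap hp,
      Complex.norm_real, Real.norm_of_nonneg (by positivity)]
    have hn : 1 / ((n : ℝ) + 1) ≤ 1 := by
      rw [div_le_one (by positivity)]
      linarith [n.cast_nonneg (α := ℝ)]
    have : ‖(F + ((1 / ((n : ℝ) + 1) : ℝ) : ℂ) • f : Space p) z‖ ≤ ‖F z‖ + ‖f z‖ := by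
      simp only [map_add, map_smul, Pi.add_apply, Pi.smul_apply, smul_eq_mul]
      refine (norm_add_le _ _).trans ?_
      rw [norm_mul, Complex.norm_real, Real.norm_of_nonneg (by positivity)]
      nlinarith [norm_nonneg (f z)]
    have := sub_nonneg.2 hp.le
    gcongr
  · have h1 : Filter.Tendsto (fun n : ℕ => F z + ((1 / ((n : ℝ) + 1) : ℝ) : ℂ) * f z) Filter.atTop
        (nhds (F z + ((0 : ℝ) : ℂ) * f z)) :=
      (((Complex.continuous_ofReal.tendsto 0).comp
        tendsto_one_div_add_atTop_nhds_zero_nat).mul_const _).const_add _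
    rw [Complex.ofReal_zero, zero_mul, add_zero] at h1
    simp only [dualFun_apply, map_add, map_smul, Pi.add_apply, Pi.smul_apply, smul_eq_mul]
    exact ((Complex.continuous_conj.comp (continuous_dualMap hp)).tendsto _ |>.comp h1).const_mul _

theorem re_apply_le_of_isExtremal [Fact (1 < p)] (hpq : p.HolderConjugate q) {F : Space p}
    {φ : Space p →L[ℂ] ℂ} (hφ : IsExtremal φ F) (f : Space p) :
    (φ f).re / ‖φ‖ ≤ (∫ z, f z * starRingEnd ℂ (dualFun p F z) ∂σ).re := by
  have hN : 0 < ‖φ‖ := norm_pos_iff.2 hφ.ne_zero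
  have hp := hpq.pos
  refine ge_of_tendsto' ((Complex.continuous_re.tendsto _).comp
    (tendsto_integral_mul_conj_dualFun hpq F f)) fun n => ?_
  set t : ℝ := 1 / ((n : ℝ) + 1) with ht
  have ht0 : 0 < t := by positivity
  set H : Space p := F + (t : ℂ) • f with hH
  set c := (φ f).re / ‖φ‖ with hc
  -- Extremality enters here: `Re φ(H) = ‖φ‖ (1 + t c)` is at most `‖φ‖ ‖H‖`.
  have h1 : 1 + t * c ≤ ‖H‖ := by
    have := (Complex.re_le_norm _).trans (φ.le_opNorm H)
    rw [hH, map_add, map_smul, Complex.add_re, hφ.eq_norm, smul_eq_mul, Complex.re_ofReal_mul,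
      ← hH] at this
    have h2 : (φ f).re = c * ‖φ‖ := by rw [hc, div_mul_cancel₀ _ hN.ne']
    rw [h2] at this
    refine le_of_mul_le_mul_left ?_ hN
    linarith
  have h2 : 1 + p * (‖H‖ - 1) ≤ ‖H‖ ^ p := by
    have := one_add_mul_self_le_rpow_one_add (s := ‖H‖ - 1) (by linarith [norm_nonneg H]) hpq.lt.le
    rwa [add_sub_cancel] at this
  -- The tangent is taken at `H` and compared at `F`. This bounds `‖H‖ ^ p` from above, against the
  -- lower bound `1 + p t c`; dividing by `p t` leaves `c ≤ r`.
  have h3 := norm_rpow_add_re_integral_le hpq H F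
  have h4 : ∫ z, (F - H) z * starRingEnd ℂ (dualFun p H z) ∂σ
      = -((t : ℂ) * ∫ z, f z * starRingEnd ℂ (dualFun p H z) ∂σ) := by
    rw [← integral_const_mul, ← integral_neg]
    congr 1 with z
    have : F - H = -((t : ℂ) • f) := by rw [hH]; abel
    rw [this]
    simp only [map_neg, map_smul, Pi.neg_apply, Pi.smul_apply, smul_eq_mul]
    ring
  rw [h4, hφ.norm_eq_one, Real.one_rpow, Complex.neg_re, Complex.re_ofReal_mul] at h3
  simp only [Function.comp_apply]
  set r := (∫ z, f z * starRingEnd ℂ (dualFun p H z) ∂σ).re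
  have h5 : (p * t) * c ≤ (p * t) * r := by nlinarith
  exact le_of_mul_le_mul_left h5 (by positivity)

/-- A real-linear inequality between functionals is an equality, by passing to `-g`; multiplication
by `I` recovers the imaginary parts. -/
theorem apply_div_norm_eq_of_isExtremal [Fact (1 < p)] (hpq : p.HolderConjugate q) {F : Space p}
    {φ : Space p →L[ℂ] ℂ} (hφ : IsExtremal φ F) (f : Space p) :
    φ f / ((‖φ‖ : ℝ) : ℂ) = ∫ z, f z * starRingEnd ℂ (dualFun p F z) ∂σ := by
  set ψ := functional hpq (memLp_dualFun hpq F)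
  have hle : ∀ g : Space p, (φ g).re / ‖φ‖ ≤ (ψ g).re := re_apply_le_of_isExtremal hpq hφ
  have hre : ∀ g : Space p, (φ g).re / ‖φ‖ = (ψ g).re := fun g => by
    refine le_antisymm (hle g) ?_
    have := hle (-g)
    rw [map_neg, map_neg, Complex.neg_re, Complex.neg_re, neg_div] at this
    linarith
  change _ = ψ f
  apply Complex.ext
  · rw [Complex.div_ofReal_re, hre]
  · have := hre (Complex.I • f)
    rw [map_smul, map_smul, smul_eq_mul, smul_eq_mul, Complex.I_mul_re, Complex.I_mul_re,
      neg_div, neg_inj] at this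
    rw [Complex.div_ofReal_im, this]

/-! ### Testing on kernel functions -/

/-- The Bergman kernel function at `z`, as an element of `A^p`. -/
def kernelFun (p : ℝ) (z : Disc) : Space p :=
  ⟨fun w => 1 / (1 - starRingEnd ℂ (z : ℂ) * (w : ℂ)) ^ 2, by
    have hd : DifferentiableOn ℂ (fun w : ℂ => 1 / (1 - starRingEnd ℂ (z : ℂ) * w) ^ 2)
        (Metric.ball 0 1) :=
      (differentiableOn_const 1).div (by fun_prop) fun w hw =>
        pow_ne_zero 2 (one_sub_conj_mul_ne_zero (Disc.norm_lt_one z) (mem_ball_zero_iff.1 hw))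
    have ha : IsAnalytic fun w : Disc => 1 / (1 - starRingEnd ℂ (z : ℂ) * (w : ℂ)) ^ 2 :=
      ⟨_, hd, fun _ => rfl⟩
    refine ⟨ha, MemLp.of_bound ha.continuous.aestronglyMeasurable (1 / (1 - ‖(z : ℂ)‖) ^ 2)
      (ae_of_all _ fun w => ?_)⟩
    have h0 : 0 < 1 - ‖(z : ℂ)‖ := sub_pos.2 (Disc.norm_lt_one z)
    have h1 := one_sub_norm_le_norm_one_sub_conj_mul w z
    have h2 : starRingEnd ℂ (1 - starRingEnd ℂ (w : ℂ) * z) = 1 - starRingEnd ℂ (z : ℂ) * w := by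
      simp [mul_comm]
    rw [← RCLike.norm_conj (1 - _), h2] at h1
    rw [norm_div, norm_pow, norm_one]
    gcongr⟩

theorem integral_kernelFun_mul_conj (z : Disc) (h : Disc → ℂ) :
    ∫ w, kernelFun p z w * starRingEnd ℂ (h w) ∂σ = starRingEnd ℂ (proj h z) := by
  rw [proj, ← integral_conj]
  congr 1 with w
  change 1 / (1 - starRingEnd ℂ (z : ℂ) * (w : ℂ)) ^ 2 * _ = _
  simp only [map_div₀, map_pow, map_sub, map_one, map_mul, Complex.conj_conj]
  rw [mul_comm (w : ℂ)]
  ring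

end

end Bergman

theorem mainTheorem2 (p q : ℝ) [Fact (1 < p)] (hpq : 1 / p + 1 / q = 1)
    (F : Bergman.Space p) (hF : ‖F‖ = 1) :
    (∃ k : Bergman.Space q, (∀ z : Disc, k z = Bergman.proj (Bergman.dualFun p F) z) ∧
      ∃ φ : Bergman.Space p →L[ℂ] ℂ, Bergman.HasKernel φ k ∧ Bergman.IsExtremal φ F ∧
        ∀ G : Bergman.Space p, Bergman.IsExtremal φ G → G = F) ∧
    (∀ (φ : Bergman.Space p →L[ℂ] ℂ) (k : Bergman.Space q),
      Bergman.HasKernel φ k → Bergman.IsExtremal φ F →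
        ∀ z : Disc, Bergman.proj (Bergman.dualFun p F) z = k z / ((‖φ‖ : ℝ) : ℂ)) := by
  have hp : 1 < p := Fact.out
  have hc : p.HolderConjugate q := Real.holderConjugate_iff.2 ⟨hp, by simpa using hpq⟩
  have hq1 : 1 ≤ ENNReal.ofReal q := by simpa using hc.symm.lt.le
  have hm := (Bergman.continuous_dualFun hp F).measurable
  have hL := Bergman.memLp_dualFun hc F
  refine ⟨?_, fun φ k hk hφ z => ?_⟩
  · obtain ⟨k, hk⟩ := (Bergman.Space.exists_iff _).2
      ⟨Bergman.isAnalytic_proj (hL.integrable hq1), Bergman.memLp_proj hc hm hL⟩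
    refine ⟨k, fun z => by rw [hk], Bergman.functional hc hL, fun f => ?_,
      Bergman.isExtremal_functional_dualFun hc hF,
      fun G hG => Bergman.eq_of_isExtremal_functional_dualFun hc hF hG⟩
    rw [hk, Bergman.functional_apply, Bergman.integral_mul_conj_proj hc f hm hL]
  -- Pairing with the kernel function at `z` evaluates projections at `z`, up to conjugation, and
  -- `k` is its own projection.
  · have h := Bergman.apply_div_norm_eq_of_isExtremal hc hφ (Bergman.kernelFun p z)
    rw [hk, Bergman.integral_kernelFun_mul_conj, Bergman.integral_kernelFun_mul_conj,
      Bergman.proj_eq_self k.isAnalytic (k.memLp.integrable hq1)] at h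
    have h' := congrArg (starRingEnd ℂ) h
    rw [map_div₀, Complex.conj_conj, Complex.conj_conj, Complex.conj_ofReal] at h'
    exact h'.symm
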